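/- Let $\ln\Gamma$ be the principal branch of the log-Gamma function, i.e. the analytic function on $\mathbb{C}\setminus(-\infty,0]$ with $\exp(\ln\Gamma(z))=\Gamma(z)$ that is real for real $z>0$, and write $\arg\Gamma(z):=\Im\ln\Gamma(z)$. The Riemann–Siegel theta function is $$\vartheta(t):=\arg\Gamma\left(\tfrac{it}{2}+\tfrac14\right)-\tfrac t2\log\pi\qquad(t\in\mathbb{R}),$$ so that $\vartheta$ is continuous and $\vartheta(0)=0$. Let $B_{n}(x)$ be the Bernoulli polynomials, $B_n=B_n(0)$ the Bernoulli numbers, $\{u\}=u-\lfloor u\rfloor$, and let $\log$ denote the principal branch. For integers $j,k\ge1$ and $z\ne0$ with $\Re z\ge0$ put $$T_j(z):=\frac{B_{2j}}{2j(2j-1)z^{2j-1}},\qquad R_k(z):=\int_0^\infty\frac{B_{2k}-B_{2k}(\{u\})}{2k\,(u+z)^{2k}}\,du,$$ $$\widehat T_j(z):=T_j(2z)-T_j(z),\qquad \widehat R_k(z):=R_k(2z)-R_k(z),$$ and for real $t>0$ $$\widetilde T_j(t):=\tfrac12|\widehat T_j(t)|,\qquad \widetilde R_k(t):=\Im\left(\tfrac12\widehat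 R_k(it)\right).$$ Then the following hold. 1. For all $t\in\mathbb{R}$, $$\vartheta(t)=\tfrac12\arg\Gamma\left(it+\tfrac12\right)-\tfrac12t\log(2\pi)-\tfrac\pi8+\tfrac12\arctan(e^{-\pi t}).$$ 2. $R_k$ is the remainder in Stirling's approximation: for all $k\ge1$ and all $z\ne0$ with $\Re z\ge0$, $$\ln\Gamma(z)=(z-\tfrac12)\log z-z+\tfrac12\log(2\pi)+\sum_{j=1}^{k-1}T_j(z)+R_k(z).$$ 3. For all $j\ge1$ and $t>0$, $$\widetilde T_j(t)=\frac{|B_{2j}(\frac12)|}{4j(2j-1)t^{2j-1}}.$$ 4. For all $k\ge1$ and all real $t>0$, $$\vartheta(t)=\frac t2\log\left(\frac{t}{2\pi e}\right)-\frac\pi8+\frac{\arctan(e^{-\pi t})}{2}+\sum_{j=1}^{k-1}\widetilde T_j(t)+\widetilde R_k(t).$$ -/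

import Mathlib

namespace RiemannSiegel

open Complex MeasureTheory

/-! ### The log-Gamma function on the cut plane -/

/-- The principal branch of `ln Γ` on `ℂ \ (-∞, 0]`: the primitive of `Γ'/Γ` that vanishes at `1`,
given by integrating `Γ'/Γ` along the segment from `1` to `z`.  The facts `differentiableOn_logGamma`,
`exp_logGamma` and `logGamma_ofReal` below say that it is analytic on the cut plane, is a logarithm
of `Γ` there, and is real (equal to `log (Γ x)`) at positive reals `x`. -/
noncomputable def logGamma (z : ℂ) : ℂ :=
  ∫ s in (0 : ℝ)..1, (z - 1) * digamma (1 + s * (z - 1))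

theorem ne_neg_nat_of_mem_slitPlane {z : ℂ} (hz : z ∈ slitPlane) (m : ℕ) : z ≠ -m := by
  rintro rfl
  rw [mem_slitPlane_iff] at hz
  rcases hz with h | h
  · have : (0 : ℝ) ≤ m := Nat.cast_nonneg m
    simp at h
    linarith
  · simp at h

theorem Gamma_ne_zero_of_mem_slitPlane {z : ℂ} (hz : z ∈ slitPlane) : Gamma z ≠ 0 :=
  Gamma_ne_zero (ne_neg_nat_of_mem_slitPlane hz)

theorem differentiableOn_digamma : DifferentiableOn ℂ digamma slitPlane := by
  have h : DifferentiableOn ℂ Gamma slitPlane := fun z hz =>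
    (differentiableAt_Gamma z (ne_neg_nat_of_mem_slitPlane hz)).differentiableWithinAt
  exact (h.deriv isOpen_slitPlane).div h fun z hz => Gamma_ne_zero_of_mem_slitPlane hz

theorem segment_mem_slitPlane {z : ℂ} (hz : z ∈ slitPlane) {s : ℝ} (hs : s ∈ Set.Icc (0 : ℝ) 1) :
    1 + (s : ℂ) * (z - 1) ∈ slitPlane := by
  have h := starConvex_one_slitPlane.add_smul_mem (y := z - 1) (by simpa using hz) hs.1 hs.2
  simpa using h

theorem hasDerivAt_logGamma {z : ℂ} (hz : z ∈ slitPlane) : HasDerivAt logGamma (digamma z) z := by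
  have hd := differentiableOn_digamma
  have hd' : ∀ w ∈ slitPlane, HasDerivAt digamma (deriv digamma w) w := fun w hw =>
    (hd.differentiableAt (isOpen_slitPlane.mem_nhds hw)).hasDerivAt
  have hc : ContinuousOn digamma slitPlane := hd.continuousOn
  have hc' : ContinuousOn (deriv digamma) slitPlane :=
    (hd.deriv isOpen_slitPlane).continuousOn
  obtain ⟨ε, hε, hball⟩ := Metric.nhds_basis_closedBall.mem_iff.1 (isOpen_slitPlane.mem_nhds hz)
  let F' : ℂ → ℝ → ℂ := fun w s =>
    digamma (1 + s * (w - 1)) + (w - 1) * (deriv digamma (1 + s * (w - 1)) * s)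
  have hmaps : Set.MapsTo (fun p : ℂ × ℝ => 1 + (p.2 : ℂ) * (p.1 - 1))
      (Metric.closedBall z ε ×ˢ Set.Icc (0 : ℝ) 1) slitPlane := fun p hp =>
    segment_mem_slitPlane (hball hp.1) hp.2
  have hline : Continuous (fun p : ℂ × ℝ => 1 + (p.2 : ℂ) * (p.1 - 1)) := by fun_prop
  have hF'c : ContinuousOn (fun p : ℂ × ℝ => F' p.1 p.2)
      (Metric.closedBall z ε ×ˢ Set.Icc (0 : ℝ) 1) := by
    refine (hc.comp hline.continuousOn hmaps).add ?_
    refine ContinuousOn.mul (by fun_prop) ((hc'.comp hline.continuousOn hmaps).mul (by fun_prop))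
  obtain ⟨C, hC⟩ := ((isCompact_closedBall z ε).prod isCompact_Icc).exists_bound_of_continuousOn hF'c
  have hslice : ∀ w ∈ slitPlane, ContinuousOn (fun s : ℝ => (w - 1) * digamma (1 + s * (w - 1)))
      (Set.uIcc 0 1) := fun w hw => by
    rw [Set.uIcc_of_le zero_le_one]
    exact continuousOn_const.mul (hc.comp (by fun_prop) fun s hs => segment_mem_slitPlane hw hs)
  have hslice' : ContinuousOn (F' z) (Set.uIcc 0 1) := by
    rw [Set.uIcc_of_le zero_le_one]
    exact hF'c.comp (f := fun s : ℝ => (z, s)) (by fun_prop)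
      fun s hs => ⟨Metric.mem_closedBall_self hε.le, hs⟩
  have hIoc : ∀ s : ℝ, s ∈ Set.uIoc (0 : ℝ) 1 → s ∈ Set.Icc (0 : ℝ) 1 := fun s hs => by
    rw [Set.uIoc_of_le zero_le_one] at hs
    exact ⟨hs.1.le, hs.2⟩
  have key := (intervalIntegral.hasDerivAt_integral_of_dominated_loc_of_deriv_le
    (μ := volume) (a := 0) (b := 1)
    (F := fun (w : ℂ) (s : ℝ) => (w - 1) * digamma (1 + s * (w - 1))) (F' := F') (x₀ := z)
    (s := Metric.closedBall z ε) (bound := fun _ => C)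
    (Metric.closedBall_mem_nhds z hε)
    (by
      filter_upwards [isOpen_slitPlane.mem_nhds hz] with w hw
      exact (hslice w hw).intervalIntegrable.def'.aestronglyMeasurable)
    (hslice z hz).intervalIntegrable
    hslice'.intervalIntegrable.def'.aestronglyMeasurable
    (Filter.Eventually.of_forall fun s hs w hw => hC (w, s) ⟨hw, hIoc s hs⟩)
    intervalIntegrable_const
    (Filter.Eventually.of_forall fun s hs w hw => by
      have h1 : HasDerivAt (fun w : ℂ => 1 + (s : ℂ) * (w - 1)) s w := by
        simpa using (((hasDerivAt_id w).sub_const 1).const_mul (s : ℂ)).const_add 1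
      have h2 := (hd' _ (segment_mem_slitPlane (hball hw) (hIoc s hs))).comp w h1
      have h3 : HasDerivAt (fun w : ℂ => w - 1) 1 w := (hasDerivAt_id w).sub_const 1
      refine (h3.mul h2).congr_deriv ?_
      simp only [F', Function.comp, one_mul])).2
  have hval : ∫ s in (0 : ℝ)..1, F' z s = digamma z := by
    have hder : ∀ s ∈ Set.uIcc (0 : ℝ) 1,
        HasDerivAt (fun s : ℝ => (s : ℂ) * digamma (1 + s * (z - 1))) (F' z s) s := fun s hs => by
      rw [Set.uIcc_of_le zero_le_one] at hs
      have h0 : HasDerivAt (fun s : ℝ => (s : ℂ)) 1 s := (hasDerivAt_id s).ofReal_comp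
      have h1 : HasDerivAt (fun s : ℝ => 1 + (s : ℂ) * (z - 1)) (z - 1) s := by
        simpa using (h0.mul_const (z - 1)).const_add 1
      have h2 := (hd' _ (segment_mem_slitPlane hz hs)).comp s h1
      have h3 := h0.mul h2
      refine h3.congr_deriv ?_
      simp only [F', Function.comp]
      ring
    rw [intervalIntegral.integral_eq_sub_of_hasDerivAt hder hslice'.intervalIntegrable]
    simp
  rw [hval] at key
  exact key

theorem differentiableOn_logGamma : DifferentiableOn ℂ logGamma slitPlane := fun _ hz =>
  (hasDerivAt_logGamma hz).differentiableAt.differentiableWithinAt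

theorem logGamma_one : logGamma 1 = 0 := by simp [logGamma]

theorem exp_logGamma {z : ℂ} (hz : z ∈ slitPlane) : exp (logGamma z) = Gamma z := by
  have hder : ∀ w ∈ slitPlane, HasDerivAt (fun w => Gamma w * exp (-logGamma w)) 0 w := by
    intro w hw
    have h1 := (differentiableAt_Gamma w (ne_neg_nat_of_mem_slitPlane hw)).hasDerivAt
    have h2 := ((hasDerivAt_logGamma hw).neg).cexp
    refine (h1.mul h2).congr_deriv ?_
    have := Gamma_ne_zero_of_mem_slitPlane hw
    rw [digamma_def, logDeriv_apply]
    field_simp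
    simp
  have hpre : IsPreconnected slitPlane :=
    (starConvex_one_slitPlane.isPathConnected one_mem_slitPlane).isConnected.isPreconnected
  have hconst := isOpen_slitPlane.is_const_of_deriv_eq_zero hpre
    (fun w hw => (hder w hw).differentiableAt.differentiableWithinAt)
    (fun w hw => (hder w hw).deriv) hz one_mem_slitPlane
  simp only [logGamma_one, Gamma_one, neg_zero, exp_zero, mul_one] at hconst
  rw [exp_neg] at hconst
  field_simp at hconst
  exact hconst.symm

theorem logGamma_ofReal {x : ℝ} (hx : 0 < x) :
    logGamma x = (Real.log (Real.Gamma x) : ℂ) := by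
  have hreal : ∀ y : ℝ, 0 < y → digamma y = ((deriv Real.Gamma y / Real.Gamma y : ℝ) : ℂ) := by
    intro y hy
    have h1 := (differentiableAt_Gamma y
      (ne_neg_nat_of_mem_slitPlane (ofReal_mem_slitPlane.2 hy))).hasDerivAt.comp_ofReal
    have h2 := (Real.differentiableOn_Gamma_Ioi.differentiableAt
      (Ioi_mem_nhds hy)).hasDerivAt.ofReal_comp
    simp only [Gamma_ofReal] at h1
    rw [digamma_def, logDeriv_apply, Gamma_ofReal, h1.unique h2]
    push_cast
    rfl
  have him : (logGamma x).im = 0 := by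
    have : logGamma x = ((∫ s in (0 : ℝ)..1, (x - 1) *
        (deriv Real.Gamma (1 + s * (x - 1)) / Real.Gamma (1 + s * (x - 1))) : ℝ) : ℂ) := by
      rw [logGamma, ← intervalIntegral.integral_ofReal]
      refine intervalIntegral.integral_congr fun s hs => ?_
      rw [Set.uIcc_of_le zero_le_one] at hs
      have hpos : 0 < 1 + s * (x - 1) := by
        have := segment_mem_slitPlane (ofReal_mem_slitPlane.2 hx) hs
        rw [← ofReal_mem_slitPlane]
        exact_mod_cast this
      have := hreal _ hpos
      push_cast at this ⊢
      rw [this]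
    rw [this, ofReal_im]
  have hexp := exp_logGamma (ofReal_mem_slitPlane.2 hx)
  have hre : logGamma x = ((logGamma x).re : ℂ) := by
    apply Complex.ext <;> simp [him]
  rw [hre, Gamma_ofReal, ← ofReal_exp] at hexp
  rw [hre, ← ofReal_inj.1 hexp, Real.log_exp]

/-! ### The Riemann–Siegel theta function -/

/-- `ϑ(t) = arg Γ(it/2 + 1/4) - (t/2) log π`, with the argument that is continuous in `t` and
vanishes at `t = 0`, i.e. `arg Γ = Im (ln Γ)`; see `theta_spec`. -/
noncomputable def theta (t : ℝ) : ℝ :=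
  (logGamma (I * t / 2 + 1 / 4)).im - t / 2 * Real.log Real.pi

theorem theta_spec : Continuous theta ∧ theta 0 = 0 ∧
    ∀ t : ℝ, Gamma (I * t / 2 + 1 / 4) =
      ‖Gamma (I * t / 2 + 1 / 4)‖ * exp (I * (theta t + t / 2 * Real.log Real.pi : ℝ)) := by
  have hmem : ∀ t : ℝ, I * t / 2 + 1 / 4 ∈ slitPlane := fun t => by
    rw [mem_slitPlane_iff]
    left
    simp
  refine ⟨?_, ?_, fun t => ?_⟩
  · have h : Continuous fun t : ℝ => logGamma (I * t / 2 + 1 / 4) :=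
      differentiableOn_logGamma.continuousOn.comp_continuous (by fun_prop) hmem
    exact (continuous_im.comp h).sub (by fun_prop)
  · have h := logGamma_ofReal (x := 1 / 4) (by norm_num)
    push_cast at h
    simp only [theta, ofReal_zero, mul_zero, zero_div, zero_add, h, ofReal_im]
    simp
  · have h := exp_logGamma (hmem t)
    have h2 : theta t + t / 2 * Real.log Real.pi = (logGamma (I * t / 2 + 1 / 4)).im := by
      simp [theta]
    rw [h2, ← h, norm_exp, ofReal_exp, ← exp_add]
    congr 1
    rw [mul_comm I ((logGamma (I * t / 2 + 1 / 4)).im : ℂ)]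
    exact (re_add_im _).symm

/-! ### The terms and the remainder of Stirling's approximation -/

/-- `T_j(z) = B_{2j} / (2j (2j-1) z^{2j-1})`, for `j ≥ 1`. -/
noncomputable def stirlingT (j : ℕ) (z : ℂ) : ℂ :=
  (bernoulli (2 * j) : ℂ) / (2 * j * (2 * j - 1) * z ^ (2 * j - 1))

/-- `R_k(z) = ∫₀^∞ (B_{2k} - B_{2k}({u})) / (2k (u+z)^{2k}) du`, for `k ≥ 1`. -/
noncomputable def stirlingR (k : ℕ) (z : ℂ) : ℂ :=
  ∫ u in Set.Ioi (0 : ℝ),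
    ((bernoulli (2 * k) - bernoulliFun (2 * k) (Int.fract u) : ℝ) : ℂ) / (2 * k * (u + z) ^ (2 * k))

/-- `T̂_j(z) = T_j(2z) - T_j(z)`. -/
noncomputable def gaussT (j : ℕ) (z : ℂ) : ℂ := stirlingT j (2 * z) - stirlingT j z

/-- `R̂_k(z) = R_k(2z) - R_k(z)`. -/
noncomputable def gaussR (k : ℕ) (z : ℂ) : ℂ := stirlingR k (2 * z) - stirlingR k z

/-- `T̃_j(t) = |T̂_j(t)| / 2`. -/
noncomputable def thetaT (j : ℕ) (t : ℝ) : ℝ := 1 / 2 * ‖gaussT j t‖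

/-- `R̃_k(t) = Im (R̂_k(it) / 2)`. -/
noncomputable def thetaR (k : ℕ) (t : ℝ) : ℝ := (1 / 2 * gaussR k (I * t)).im

end RiemannSiegel

namespace RiemannSiegel

open Complex MeasureTheory Filter Topology Set

/-! ### Integrals against inverse powers of `u + z` -/

/-! Stirling's formula is first proved with remainder `R_1` at real x > 0: the integral over [0, N]
is elementary, and its limit follows from the Euler product limit for log Γ and Stirling's formula
for N!. Both sides are analytic on the slit plane, so the identity theorem extends the formula there
(`logGamma_eq_stirlingR_one`). Two integrations by parts give R_k = T_k + R_{k+1}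
(`stirlingR_eq_stirlingT_add`), hence every k.

For ϑ, put s = it/2 + 1/4. Duplication gives the sum of arg Γ(s) and arg Γ(s + 1/2). Since 1 - s is
the conjugate of s + 1/2, reflection gives their difference as -arg sin(πs), which is where the
arctangent comes from. Averaging yields `theta_eq_logGamma_one_half`. Duplication at z = it then
writes ln Γ(it + 1/2) through ln Γ(2z) - ln Γ(z). Applying Stirling to both produces the hatted
terms, and the known sign of B_{2j}(1/2) makes T̂_j(it) equal to i|T̂_j(t)| (`gaussT_I_mul`). -/

/-- Near z₀ the distance to the cut is at least ε, and |u + z| ≥ u - |z|; a linear combination of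
these two bounds gives c. Being uniform in z, the bound dominates the integrals over u and allows
differentiating under them. -/
theorem exists_ball_mul_one_add_le_norm {z₀ : ℂ} (hz₀ : z₀ ∈ slitPlane) :
    ∃ ε > 0, ∃ c > 0, ∀ z ∈ Metric.ball z₀ ε, z ∈ slitPlane ∧
      ∀ u : ℝ, 0 ≤ u → c * (1 + u) ≤ ‖(u : ℂ) + z‖ := by
  obtain ⟨δ, hδ, hball⟩ := Metric.isOpen_iff.1 isOpen_slitPlane z₀ hz₀
  have hε : 0 < δ / 2 := by linarith
  set ε := δ / 2 with hεδ
  have hM : 0 < 1 + (‖z₀‖ + ε) + ε := by positivity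
  refine ⟨ε, hε, ε / (1 + (‖z₀‖ + ε) + ε), by positivity, fun z hz => ⟨hball ?_, fun u hu => ?_⟩⟩
  · exact Metric.ball_subset_ball (by linarith) hz
  rw [Metric.mem_ball, dist_eq_norm] at hz
  have h1 : ε ≤ ‖(u : ℂ) + z‖ := by
    by_contra! h
    have hmem : -(u : ℂ) ∈ slitPlane := by
      apply hball
      rw [Metric.mem_ball, dist_eq_norm]
      have : -(u : ℂ) - z₀ = -((u : ℂ) + z) + (z - z₀) := by ring
      rw [this]
      refine (norm_add_le _ _).trans_lt ?_
      rw [norm_neg]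
      linarith
    rw [← ofReal_neg, ofReal_mem_slitPlane] at hmem
    linarith
  have h2 : u ≤ ‖(u : ℂ) + z‖ + (‖z₀‖ + ε) := by
    have e1 : (u : ℂ) = (u + z) - ((z - z₀) + z₀) := by ring
    have e2 : ‖(u : ℂ)‖ = u := by rw [norm_real, Real.norm_of_nonneg hu]
    have e3 := norm_sub_le ((u : ℂ) + z) ((z - z₀) + z₀)
    rw [← e1, e2] at e3
    linarith [norm_add_le (z - z₀) z₀]
  rw [div_mul_eq_mul_div, div_le_iff₀ hM]
  nlinarith [norm_nonneg z₀]

theorem norm_div_pow_le {f : ℝ → ℂ} {C c : ℝ} (hC : ∀ u, ‖f u‖ ≤ C) (hc : 0 < c) {z : ℂ} {u : ℝ}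
    (hu : 0 ≤ u) (h : c * (1 + u) ≤ ‖(u : ℂ) + z‖) {m : ℕ} (hm : 2 ≤ m) :
    ‖f u / (u + z) ^ m‖ ≤ C / c ^ m * (1 + u ^ 2)⁻¹ := by
  have hC0 : 0 ≤ C := (norm_nonneg _).trans (hC 0)
  rw [norm_div, norm_pow, ← div_eq_mul_inv, div_div]
  have h1 : c ^ m * (1 + u ^ 2) ≤ ‖(u : ℂ) + z‖ ^ m := by
    calc c ^ m * (1 + u ^ 2) ≤ c ^ m * (1 + u) ^ m := by
          gcongr
          calc 1 + u ^ 2 ≤ (1 + u) ^ 2 := by nlinarith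
            _ ≤ (1 + u) ^ m := pow_le_pow_right₀ (by linarith) hm
      _ = (c * (1 + u)) ^ m := by rw [mul_pow]
      _ ≤ _ := by gcongr
  gcongr
  exact hC u

theorem ofReal_add_ne_zero {z : ℂ} (hz : z ∈ slitPlane) {u : ℝ} (hu : 0 ≤ u) : (u : ℂ) + z ≠ 0 := by
  obtain ⟨ε, hε, c, hc, h⟩ := exists_ball_mul_one_add_le_norm hz
  have := (h z (Metric.mem_ball_self hε)).2 u hu
  rw [← norm_pos_iff]
  refine lt_of_lt_of_le ?_ this
  positivity

theorem continuousOn_div_pow {f : ℝ → ℂ} (hf : Continuous f) {z : ℂ} (hz : z ∈ slitPlane) (m : ℕ) :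
    ContinuousOn (fun u : ℝ => f u / (u + z) ^ m) (Ici 0) :=
  hf.continuousOn.div (by fun_prop) fun _ hu => pow_ne_zero _ (ofReal_add_ne_zero hz hu)

theorem aestronglyMeasurable_div_pow {f : ℝ → ℂ} (hf : Continuous f) {z : ℂ} (hz : z ∈ slitPlane)
    (m : ℕ) : AEStronglyMeasurable (fun u : ℝ => f u / (u + z) ^ m) (volume.restrict (Ioi 0)) :=
  ((continuousOn_div_pow hf hz m).mono Ioi_subset_Ici_self).aestronglyMeasurable measurableSet_Ioi

theorem integrableOn_div_pow {f : ℝ → ℂ} (hf : Continuous f) {C : ℝ} (hC : ∀ u, ‖f u‖ ≤ C) {z : ℂ}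
    (hz : z ∈ slitPlane) {m : ℕ} (hm : 2 ≤ m) :
    IntegrableOn (fun u : ℝ => f u / (u + z) ^ m) (Ioi 0) := by
  obtain ⟨ε, hε, c, hc, h⟩ := exists_ball_mul_one_add_le_norm hz
  have hb := (h z (Metric.mem_ball_self hε)).2
  refine Integrable.mono' (integrable_inv_one_add_sq.const_mul (C / c ^ m)).integrableOn
    (aestronglyMeasurable_div_pow hf hz m) ?_
  filter_upwards [ae_restrict_mem measurableSet_Ioi] with u hu
  exact norm_div_pow_le hC hc (le_of_lt hu) (hb u (le_of_lt hu)) hm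

/-- The z-derivative of the integrand has the same shape with exponent m + 1, so `norm_div_pow_le`
dominates it as well. -/
theorem differentiableOn_integral_div_pow {f : ℝ → ℂ} (hf : Continuous f) {C : ℝ}
    (hC : ∀ u, ‖f u‖ ≤ C) {m : ℕ} (hm : 2 ≤ m) :
    DifferentiableOn ℂ (fun z : ℂ => ∫ u in Ioi (0 : ℝ), f u / (u + z) ^ m) slitPlane := by
  intro z₀ hz₀
  obtain ⟨ε, hε, c, hc, h⟩ := exists_ball_mul_one_add_le_norm hz₀
  refine (hasDerivAt_integral_of_dominated_loc_of_deriv_le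
    (μ := volume.restrict (Ioi 0)) (F := fun z u => f u / (u + z) ^ m)
    (F' := fun z u => (-(m : ℂ) * f u) / (u + z) ^ (m + 1))
    (bound := fun u => (m * C) / c ^ (m + 1) * (1 + u ^ 2)⁻¹) (Metric.ball_mem_nhds z₀ hε)
    ?_ (integrableOn_div_pow hf hC hz₀ hm)
    (aestronglyMeasurable_div_pow (by fun_prop) hz₀ (m + 1)) ?_
    (integrable_inv_one_add_sq.const_mul _).integrableOn
    ?_).2.differentiableAt.differentiableWithinAt
  · filter_upwards [isOpen_slitPlane.mem_nhds hz₀] with z hz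
    exact aestronglyMeasurable_div_pow hf hz m
  · filter_upwards [ae_restrict_mem measurableSet_Ioi] with u hu z hz
    refine norm_div_pow_le (f := fun u => -(m : ℂ) * f u) (fun v => ?_) hc (le_of_lt hu)
      ((h z hz).2 u (le_of_lt hu)) (by omega)
    rw [norm_mul, norm_neg, Complex.norm_natCast]
    gcongr
    exact hC v
  · filter_upwards [ae_restrict_mem measurableSet_Ioi] with u hu z hz
    have hne := ofReal_add_ne_zero (h z hz).1 (le_of_lt hu)
    have h1 : HasDerivAt (fun z : ℂ => (u : ℂ) + z) 1 z := (hasDerivAt_id z).const_add _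
    have h2 := (hasDerivAt_const z (f u)).div (h1.pow m) (pow_ne_zero m hne)
    refine h2.congr_deriv ?_
    obtain ⟨n, rfl⟩ : ∃ n, m = n + 1 := ⟨m - 1, by omega⟩
    simp only [Nat.add_sub_cancel, Pi.pow_apply]
    field_simp
    ring

/-! ### Periodised Bernoulli polynomials -/

theorem continuous_bernoulliFun_fract {n : ℕ} (hn : n ≠ 1) :
    Continuous fun u : ℝ => bernoulliFun n (Int.fract u) :=
  (continuous_bernoulliFun n).continuousOn.comp_fract''
    (bernoulliFun_endpoints_eq_of_ne_one hn).symm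

theorem exists_abs_bernoulliFun_fract_le (n : ℕ) :
    ∃ C, ∀ u : ℝ, |bernoulliFun n (Int.fract u)| ≤ C := by
  obtain ⟨C, hC⟩ := isCompact_Icc.exists_bound_of_continuousOn (s := Icc (0 : ℝ) 1)
    (continuous_bernoulliFun n).continuousOn
  exact ⟨C, fun u => hC _ ⟨Int.fract_nonneg u, (Int.fract_lt_one u).le⟩⟩

theorem hasDerivAt_bernoulliFun_fract (n : ℕ) {u : ℝ} (hu : u ∉ range ((↑) : ℤ → ℝ)) :
    HasDerivAt (fun u : ℝ => bernoulliFun n (Int.fract u))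
      (n * bernoulliFun (n - 1) (Int.fract u)) u := by
  have hlt : (⌊u⌋ : ℝ) < u := lt_of_le_of_ne (Int.floor_le u) fun h => hu ⟨_, h⟩
  have h1 : HasDerivAt (fun v : ℝ => bernoulliFun n (v - ⌊u⌋))
      (n * bernoulliFun (n - 1) (u - ⌊u⌋)) u :=
    (hasDerivAt_bernoulliFun n (u - ⌊u⌋)).comp_sub_const u _
  refine h1.congr_of_eventuallyEq ?_
  filter_upwards [Ioo_mem_nhds hlt (Int.lt_floor_add_one u)] with v hv
  have : ⌊v⌋ = ⌊u⌋ := Int.floor_eq_iff.2 ⟨hv.1.le, hv.2⟩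
  rw [← Int.self_sub_floor, this]

theorem exists_norm_bernoulli_sub_le (k : ℕ) :
    ∃ C, ∀ u : ℝ, ‖((bernoulli k - bernoulliFun k (Int.fract u) : ℝ) : ℂ)‖ ≤ C := by
  obtain ⟨C, hC⟩ := exists_abs_bernoulliFun_fract_le k
  refine ⟨|(bernoulli k : ℝ)| + C, fun u => ?_⟩
  rw [norm_real, Real.norm_eq_abs]
  exact (abs_sub _ _).trans (by gcongr; exact hC u)

theorem continuous_bernoulli_sub (k : ℕ) :
    Continuous fun u : ℝ => ((bernoulli (2 * k) - bernoulliFun (2 * k) (Int.fract u) : ℝ) : ℂ) :=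
  continuous_ofReal.comp (continuous_const.sub (continuous_bernoulliFun_fract (by omega)))

theorem integrableOn_stirlingR {k : ℕ} (hk : 1 ≤ k) {z : ℂ} (hz : z ∈ slitPlane) :
    IntegrableOn (fun u : ℝ => ((bernoulli (2 * k) - bernoulliFun (2 * k) (Int.fract u) : ℝ) : ℂ) /
      (2 * k * (u + z) ^ (2 * k))) (Ioi 0) := by
  obtain ⟨C, hC⟩ := exists_norm_bernoulli_sub_le (2 * k)
  have h := (integrableOn_div_pow (continuous_bernoulli_sub k) hC hz (m := 2 * k) (by omega)).const_mul
    ((2 * k : ℂ)⁻¹)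
  refine h.congr (Eventually.of_forall fun u => ?_)
  simp only [div_eq_mul_inv, mul_inv]
  ring

theorem differentiableOn_stirlingR {k : ℕ} (hk : 1 ≤ k) :
    DifferentiableOn ℂ (stirlingR k) slitPlane := by
  obtain ⟨C, hC⟩ := exists_norm_bernoulli_sub_le (2 * k)
  have h := (differentiableOn_integral_div_pow (continuous_bernoulli_sub k) hC (m := 2 * k)
    (by omega)).const_mul ((2 * k : ℂ)⁻¹)
  refine h.congr fun z _ => ?_
  rw [stirlingR, ← integral_const_mul]
  refine integral_congr_ae (Eventually.of_forall fun u => ?_)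
  simp only [div_eq_mul_inv, mul_inv]
  ring

/-! ### The recursion between consecutive remainders -/

theorem tendsto_div_pow_atTop {f : ℝ → ℂ} {C : ℝ} (hC : ∀ u, ‖f u‖ ≤ C) (z : ℂ) {m : ℕ}
    (hm : m ≠ 0) : Tendsto (fun u : ℝ => f u / (u + z) ^ m) atTop (𝓝 0) := by
  have h1 : Tendsto (fun u : ℝ => ‖(u : ℂ) + z‖) atTop atTop := by
    refine tendsto_atTop_mono (fun u => ?_) (tendsto_atTop_add_const_right atTop (-‖z‖) tendsto_id)
    have := norm_sub_le ((u : ℂ) + z) z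
    rw [add_sub_cancel_right, norm_real] at this
    have h2 := Real.le_norm_self u
    simp only [id]
    linarith
  have h2 : Tendsto (fun u : ℝ => C / ‖(u : ℂ) + z‖ ^ m) atTop (𝓝 0) :=
    Tendsto.const_div_atTop ((tendsto_pow_atTop hm).comp h1) C
  refine squeeze_zero_norm (fun u => ?_) h2
  rw [norm_div, norm_pow]
  gcongr
  exact hC u

/-- A primitive, off the integers, of the difference of the integrands of `R_k` and `R_{k+1}`. -/
noncomputable def stirlingPrimitive (k : ℕ) (z : ℂ) (u : ℝ) : ℂ :=
  -((bernoulli (2 * k) : ℂ) / (2 * k * (2 * k - 1))) / (u + z) ^ (2 * k - 1)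
    - ((bernoulliFun (2 * k + 1) (Int.fract u) : ℂ) / ((2 * k + 1) * (2 * k))) / (u + z) ^ (2 * k)
    + (((bernoulli (2 * (k + 1)) - bernoulliFun (2 * (k + 1)) (Int.fract u) : ℝ) : ℂ)
        / ((2 * k + 2) * (2 * k + 1))) / (u + z) ^ (2 * k + 1)

/-- Only periodised Bernoulli polynomials of degree at least 3 occur, so there are no jumps at the
integers; this is what permits the fundamental theorem of calculus with a countable exceptional set.
-/
theorem continuousOn_stirlingPrimitive {k : ℕ} (hk : 1 ≤ k) {z : ℂ} (hz : z ∈ slitPlane) :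
    ContinuousOn (stirlingPrimitive k z) (Ici 0) := by
  have hc := (continuous_bernoulliFun_fract (n := 2 * k + 1) (by omega))
  refine ((continuousOn_div_pow continuous_const hz _).sub
    (continuousOn_div_pow ?_ hz _)).add (continuousOn_div_pow ?_ hz _)
  · exact (continuous_ofReal.comp hc).div_const _
  · exact (continuous_bernoulli_sub (k + 1)).div_const _

theorem tendsto_stirlingPrimitive_atTop {k : ℕ} (hk : 1 ≤ k) (z : ℂ) :
    Tendsto (stirlingPrimitive k z) atTop (𝓝 0) := by
  obtain ⟨C, hC⟩ := exists_abs_bernoulliFun_fract_le (2 * k + 1)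
  obtain ⟨C', hC'⟩ := exists_norm_bernoulli_sub_le (2 * (k + 1))
  have h := ((tendsto_div_pow_atTop (C := _)
    (f := fun _ => -((bernoulli (2 * k) : ℂ) / (2 * k * (2 * k - 1)))) (fun _ => le_rfl) z
    (m := 2 * k - 1) (by omega)).sub
    (tendsto_div_pow_atTop (C := C / ‖((2 * k + 1) * (2 * k) : ℂ)‖) (f := fun u =>
      (bernoulliFun (2 * k + 1) (Int.fract u) : ℂ) / ((2 * k + 1) * (2 * k))) (fun u => ?_) z
      (m := 2 * k) (by omega))).add
    (tendsto_div_pow_atTop (C := C' / ‖((2 * k + 2) * (2 * k + 1) : ℂ)‖) (f := fun u =>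
      ((bernoulli (2 * (k + 1)) - bernoulliFun (2 * (k + 1)) (Int.fract u) : ℝ) : ℂ)
        / ((2 * k + 2) * (2 * k + 1))) (fun u => ?_) z
      (m := 2 * k + 1) (by omega))
  · rw [sub_zero, add_zero] at h
    exact h
  · rw [norm_div, norm_real]
    gcongr
    exact hC u
  · rw [norm_div]
    gcongr
    exact hC' u

theorem hasDerivAt_const_div_pow {f : ℝ → ℂ} {f' : ℂ} {z : ℂ} {u : ℝ} (hf : HasDerivAt f f' u)
    (hne : (u : ℂ) + z ≠ 0) (m : ℕ) :
    HasDerivAt (fun u : ℝ => f u / (u + z) ^ m) (f' / (u + z) ^ m - m * f u / (u + z) ^ (m + 1))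
      u := by
  have h0 : HasDerivAt (fun u : ℝ => (u : ℂ)) 1 u := (hasDerivAt_id u).ofReal_comp
  have h1 : HasDerivAt (fun u : ℝ => (u : ℂ) + z) 1 u := h0.add_const z
  refine (hf.div (h1.pow m) (pow_ne_zero m hne)).congr_deriv ?_
  rcases m with _ | n
  · simp
  simp only [Nat.add_sub_cancel, Pi.pow_apply]
  field_simp
  push_cast
  ring

/-- This is integration by parts done twice: the B_{2k+1} contributions of the second and third
summands cancel. -/
theorem hasDerivAt_stirlingPrimitive {k : ℕ} (hk : 1 ≤ k) {z : ℂ} (hz : z ∈ slitPlane) {u : ℝ}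
    (hu : 0 ≤ u) (hu' : u ∉ range ((↑) : ℤ → ℝ)) :
    HasDerivAt (stirlingPrimitive k z)
      (((bernoulli (2 * k) - bernoulliFun (2 * k) (Int.fract u) : ℝ) : ℂ) /
          (2 * k * (u + z) ^ (2 * k)) -
        ((bernoulli (2 * (k + 1)) - bernoulliFun (2 * (k + 1)) (Int.fract u) : ℝ) : ℂ) /
          (2 * (k + 1 : ℕ) * (u + z) ^ (2 * (k + 1)))) u := by
  have hne := ofReal_add_ne_zero hz hu
  have h1 := hasDerivAt_const_div_pow
    (hasDerivAt_const u (-((bernoulli (2 * k) : ℂ) / (2 * k * (2 * k - 1))))) hne (2 * k - 1)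
  have h2 := hasDerivAt_const_div_pow
    ((hasDerivAt_bernoulliFun_fract (2 * k + 1) hu').ofReal_comp.div_const
      (((2 * k + 1) * (2 * k) : ℂ))) hne (2 * k)
  have h3 := hasDerivAt_const_div_pow
    (((hasDerivAt_bernoulliFun_fract (2 * (k + 1)) hu').const_sub
      (bernoulli (2 * (k + 1)) : ℝ)).ofReal_comp.div_const
      (((2 * k + 2) * (2 * k + 1) : ℂ))) hne (2 * k + 1)
  refine ((h1.sub h2).add h3).congr_deriv ?_
  -- Substituting k = n + 1 removes truncated subtraction from the exponents.
  obtain ⟨n, rfl⟩ : ∃ n, k = n + 1 := ⟨k - 1, by omega⟩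
  have e1 : 2 * (n + 1) - 1 = 2 * n + 1 := by omega
  have e2 : 2 * (n + 1) + 1 - 1 = 2 * (n + 1) := by omega
  have e3 : 2 * (n + 1 + 1) - 1 = 2 * (n + 1) + 1 := by omega
  have n1 : (n : ℂ) + 1 ≠ 0 := by exact_mod_cast n.succ_ne_zero
  have n2 : 2 * (n : ℂ) + 1 ≠ 0 := by exact_mod_cast (2 * n).succ_ne_zero
  have n3 : 2 * (n : ℂ) + 3 ≠ 0 := by exact_mod_cast (2 * n + 2).succ_ne_zero
  have n4 : (n : ℂ) + 2 ≠ 0 := by exact_mod_cast (n + 1).succ_ne_zero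
  rw [e1, e2, e3]
  push_cast
  have n5 : 2 * ((n : ℂ) + 1) - 1 ≠ 0 := by convert n2 using 1; ring
  have n6 : 2 * ((n : ℂ) + 1) + 1 ≠ 0 := by convert n3 using 1; ring
  have n7 : 2 * ((n : ℂ) + 1) + 2 ≠ 0 := by
    convert mul_ne_zero two_ne_zero n4 using 1; ring
  have n8 : ((n : ℂ) + 1) + 1 ≠ 0 := by convert n4 using 1; ring
  generalize (bernoulli (2 * (n + 1)) : ℂ) = b
  generalize (bernoulli (2 * (n + 1 + 1)) : ℂ) = b'
  generalize (bernoulliFun (2 * (n + 1)) (Int.fract u) : ℂ) = p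
  generalize (bernoulliFun (2 * (n + 1) + 1) (Int.fract u) : ℂ) = p₁
  generalize (bernoulliFun (2 * (n + 1 + 1)) (Int.fract u) : ℂ) = p₂
  generalize (u : ℂ) + z = y at hne
  generalize (n : ℂ) = N at *
  field_simp
  ring

/-- The middle summand dies because B_{2k+1} = 0, and the last because its numerator was normalised
to vanish at 0. -/
theorem stirlingPrimitive_zero {k : ℕ} (hk : 1 ≤ k) (z : ℂ) :
    stirlingPrimitive k z 0 = -stirlingT k z := by
  have h1 : bernoulliFun (2 * k + 1) 0 = 0 := by
    rw [bernoulliFun_eval_zero, bernoulli_eq_zero_of_odd ⟨k, rfl⟩ (by omega), Rat.cast_zero]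
  rw [stirlingPrimitive, stirlingT, Int.fract_zero, h1, bernoulliFun_eval_zero]
  simp only [ofReal_zero, zero_add, sub_self, zero_div, sub_zero, add_zero, neg_div, div_div]

theorem stirlingR_eq_stirlingT_add {k : ℕ} (hk : 1 ≤ k) {z : ℂ} (hz : z ∈ slitPlane) :
    stirlingR k z = stirlingT k z + stirlingR (k + 1) z := by
  have hi := integrableOn_stirlingR hk hz
  have hi' := integrableOn_stirlingR (k := k + 1) (by omega) hz
  have hd := hi.sub hi'
  have hcount : (range ((↑) : ℤ → ℝ)).Countable := countable_range _
  have h1 := intervalIntegral_tendsto_integral_Ioi 0 hd tendsto_id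
  have h2 : Tendsto (fun b => stirlingPrimitive k z b - stirlingPrimitive k z 0) atTop
      (𝓝 (0 - stirlingPrimitive k z 0)) := (tendsto_stirlingPrimitive_atTop hk z).sub_const _
  have h3 := tendsto_nhds_unique (h1.congr' ?_) h2
  · rw [stirlingPrimitive_zero hk, zero_sub, neg_neg] at h3
    have h4 := integral_sub hi hi'
    rw [stirlingR, stirlingR, ← h3]
    exact eq_add_of_sub_eq h4.symm
  · filter_upwards [eventually_ge_atTop 0] with b hb
    refine MeasureTheory.integral_eq_of_hasDerivAt_off_countable_of_le _ _ hb hcount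
      ((continuousOn_stirlingPrimitive hk hz).mono Icc_subset_Ici_self)
      (fun u hu => hasDerivAt_stirlingPrimitive hk hz hu.1.1.le hu.2) ?_
    exact (intervalIntegrable_iff_integrableOn_Ioc_of_le hb).2 <| hd.mono_set Ioc_subset_Ioi_self

/-! ### Stirling's formula at positive reals -/

theorem integral_stirlingR_one_unit_interval {x : ℝ} (hx : 0 < x) (n : ℕ) :
    ∫ u in (n : ℝ)..(n + 1 : ℕ), ((bernoulli (2 * 1) - bernoulliFun (2 * 1) (Int.fract u) : ℝ) : ℂ) /
      (2 * (1 : ℕ) * ((u : ℂ) + x) ^ (2 * 1)) =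
    (((x + n + 1 / 2) * (Real.log (x + n + 1) - Real.log (x + n)) - 1 : ℝ) : ℂ) := by
  have hn : (0 : ℝ) ≤ n := n.cast_nonneg
  have hle : (n : ℝ) ≤ (n + 1 : ℕ) := by push_cast; linarith
  have hxs : (x : ℂ) ∈ slitPlane := ofReal_mem_slitPlane.2 hx
  -- On this interval B_2 - B_2({u}) = v - v² with v = u - n. Expanding in powers of u + x and
  -- integrating termwise gives F.
  let F : ℝ → ℝ := fun u => -(u + x) / 2 + (x + n + 1 / 2) * Real.log (u + x) +
    (x + n) * (1 + (x + n)) / 2 / (u + x)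
  have hF : ∀ u : ℝ, (n : ℝ) ≤ u → HasDerivAt F (((u - n) - (u - n) ^ 2) / (2 * (u + x) ^ 2)) u := by
    intro u hu
    have hne : u + x ≠ 0 := by linarith
    have h1 : HasDerivAt (fun u : ℝ => u + x) 1 u := (hasDerivAt_id u).add_const x
    have h2 := ((h1.neg.div_const 2).add ((h1.log hne).const_mul (x + n + 1 / 2))).add
      ((hasDerivAt_const u ((x + n) * (1 + (x + n)) / 2)).div h1 hne)
    refine h2.congr_deriv ?_
    field_simp
    ring
  rw [intervalIntegral.integral_eq_sub_of_hasDerivAt_of_le hle (f := fun u => (F u : ℂ))]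
  · rw [← ofReal_sub]
    congr 1
    have a1 : (n : ℝ) + x ≠ 0 := by linarith
    have a2 : ((n + 1 : ℕ) : ℝ) + x ≠ 0 := by push_cast; linarith
    have e1 : x + n + 1 = (n + 1 : ℕ) + x := by push_cast; ring
    simp only [F]
    rw [e1, add_comm x (n : ℝ)]
    field_simp
    push_cast
    ring
  · exact fun u hu => (hF u hu.1).ofReal_comp.continuousAt.continuousWithinAt
  · intro u hu
    have hfl : ⌊u⌋ = n := Int.floor_eq_iff.2 ⟨by exact_mod_cast hu.1.le, by exact_mod_cast hu.2⟩
    refine (hF u hu.1.le).ofReal_comp.congr_deriv ?_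
    rw [← Int.self_sub_floor, hfl, show 2 * 1 = 2 from rfl, bernoulliFun_two, bernoulli_two]
    push_cast
    congr 1
    · ring
    · ring
  · refine (intervalIntegrable_iff_integrableOn_Ioc_of_le hle).2
      ((integrableOn_stirlingR le_rfl hxs).mono_set ?_)
    exact fun u hu => lt_of_le_of_lt hn hu.1

theorem integral_stirlingR_one_nat {x : ℝ} (hx : 0 < x) (N : ℕ) :
    ∫ u in (0 : ℝ)..(N : ℕ), ((bernoulli (2 * 1) - bernoulliFun (2 * 1) (Int.fract u) : ℝ) : ℂ) /
      (2 * (1 : ℕ) * ((u : ℂ) + x) ^ (2 * 1)) =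
    (((x + N - 1 / 2) * Real.log (x + N) - N - (x - 1 / 2) * Real.log x
      - ∑ n ∈ Finset.range N, Real.log (x + n) : ℝ) : ℂ) := by
  have hint : ∀ a b : ℝ, 0 ≤ a → a ≤ b → IntervalIntegrable (fun u : ℝ =>
      ((bernoulli (2 * 1) - bernoulliFun (2 * 1) (Int.fract u) : ℝ) : ℂ) /
      (2 * (1 : ℕ) * ((u : ℂ) + x) ^ (2 * 1))) volume a b := fun a b ha hab =>
    (intervalIntegrable_iff_integrableOn_Ioc_of_le hab).2
      ((integrableOn_stirlingR le_rfl (ofReal_mem_slitPlane.2 hx)).mono_set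
        fun u hu => lt_of_le_of_lt ha hu.1)
  induction N with
  | zero => simp
  | succ N ih =>
    rw [← intervalIntegral.integral_add_adjacent_intervals (hint 0 N le_rfl N.cast_nonneg)
      (hint N (N + 1 : ℕ) N.cast_nonneg (by push_cast; linarith)), ih,
      integral_stirlingR_one_unit_interval hx, ← ofReal_add, Finset.sum_range_succ]
    congr 1
    rw [Nat.cast_succ, ← add_assoc]
    ring

/-- Write x + N + 1 = N(1 + (x+1)/N), use N log(1 + (x+1)/N) → x + 1, and replace log N! by the
logarithm of the Stirling sequence, which tends to log √π. -/
theorem tendsto_stirling_shift_sub_log_factorial (x : ℝ) :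
    Tendsto (fun N : ℕ => (x + (N + 1 : ℕ) - 1 / 2) * Real.log (x + (N + 1 : ℕ)) - (N + 1 : ℕ)
      - x * Real.log N - Real.log (N.factorial)) atTop (𝓝 (x - 1 / 2 * Real.log (2 * Real.pi))) := by
  have hN : Tendsto (fun N : ℕ => (N : ℝ)) atTop atTop := tendsto_natCast_atTop_atTop
  have hl := (Real.tendsto_mul_log_one_add_div_atTop (x + 1)).comp hN
  have h0 : Tendsto (fun N : ℕ => (x + 1) / (N : ℝ)) atTop (𝓝 0) := hN.const_div_atTop _
  have hl0 : Tendsto (fun N : ℕ => Real.log (1 + (x + 1) / (N : ℝ))) atTop (𝓝 0) := by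
    have h1 : Tendsto (fun N : ℕ => 1 + (x + 1) / (N : ℝ)) atTop (𝓝 1) := by
      simpa using h0.const_add 1
    simpa using h1.log one_ne_zero
  have hs := Stirling.tendsto_stirlingSeq_sqrt_pi.log (Real.sqrt_pos.2 Real.pi_pos).ne'
  have hlim := (((hl.add (hl0.const_mul (x + 1 / 2))).sub hs).sub_const
    (1 / 2 * Real.log 2 + 1))
  have hval : x + 1 + (x + 1 / 2) * 0 - Real.log √Real.pi - (1 / 2 * Real.log 2 + 1) =
      x - 1 / 2 * Real.log (2 * Real.pi) := by
    rw [Real.log_sqrt Real.pi_pos.le, Real.log_mul two_ne_zero Real.pi_ne_zero]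
    ring
  rw [hval] at hlim
  refine hlim.congr' ?_
  filter_upwards [eventually_gt_atTop 0, hN.eventually (eventually_gt_atTop (-(x + 1)))] with N hN0 hNx
  have hNp : (0 : ℝ) < N := Nat.cast_pos.2 hN0
  have e1 : x + (N + 1 : ℕ) = N * (1 + (x + 1) / N) := by
    push_cast
    field_simp
    ring
  have e2 : (0 : ℝ) < 1 + (x + 1) / N := by
    rw [← mul_pos_iff_of_pos_left hNp, ← e1]
    push_cast
    linarith
  have e3 := Stirling.log_stirlingSeq_formula N
  rw [Real.log_div hNp.ne' (Real.exp_ne_zero _), Real.log_exp,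
    Real.log_mul two_ne_zero hNp.ne'] at e3
  have e4 : Real.log (x + (N + 1 : ℕ)) = Real.log N + Real.log (1 + (x + 1) / N) := by
    rw [e1, Real.log_mul hNp.ne' e2.ne']
  rw [e4, e3]
  simp only [Function.comp]
  push_cast
  ring

theorem logGamma_eq_stirlingR_one_ofReal {x : ℝ} (hx : 0 < x) :
    logGamma x = (x - 1 / 2) * log x - x + 1 / 2 * Real.log (2 * Real.pi) + stirlingR 1 x := by
  -- The upper limit is N + 1 because `logGammaSeq x N` contains the N + 1 logarithms log(x + m), m
  -- = 0, …, N.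
  have h1 := ((intervalIntegral_tendsto_integral_Ioi 0
    (integrableOn_stirlingR le_rfl (ofReal_mem_slitPlane.2 hx)) tendsto_natCast_atTop_atTop).comp
      (tendsto_add_atTop_nat 1))
  have h2 := (tendsto_stirling_shift_sub_log_factorial x).add
    (Real.BohrMollerup.tendsto_log_gamma hx)
  have h3 := h2.sub_const ((x - 1 / 2) * Real.log x)
  have h4 := (continuous_ofReal.tendsto _).comp h3
  have h5 := tendsto_nhds_unique (h1.congr fun N => ?_) h4
  · rw [stirlingR, h5, logGamma_ofReal hx, ← ofReal_log hx.le]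
    push_cast
    ring
  · simp only [Function.comp]
    rw [integral_stirlingR_one_nat hx]
    congr 1
    rw [Real.BohrMollerup.logGammaSeq]
    ring

/-- The points 1 + 1/(n+1) supply the accumulation at 1 needed by the identity theorem. -/
theorem frequently_ofReal_mem_nhdsNE_one {p : ℂ → Prop} (hp : ∀ x : ℝ, 0 < x → p x) :
    ∃ᶠ z in 𝓝[≠] (1 : ℂ), p z := by
  have h1 : Tendsto (fun n : ℕ => 1 + 1 / ((n : ℝ) + 1)) atTop (𝓝 (1 + 0)) :=
    tendsto_one_div_add_atTop_nhds_zero_nat.const_add 1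
  rw [add_zero] at h1
  have h2 : Tendsto (fun n : ℕ => ((1 + 1 / ((n : ℝ) + 1) : ℝ) : ℂ)) atTop (𝓝[≠] (1 : ℂ)) := by
    refine tendsto_nhdsWithin_iff.2 ⟨?_, Eventually.of_forall fun n => ?_⟩
    · have := (continuous_ofReal.tendsto 1).comp h1
      rwa [ofReal_one] at this
    · have : (0 : ℝ) < 1 / ((n : ℝ) + 1) := by positivity
      rw [mem_compl_iff, mem_singleton_iff, ofReal_eq_one]
      linarith
  refine h2.frequently (Frequently.of_forall fun n => hp _ (by positivity))

theorem isPreconnected_slitPlane : IsPreconnected slitPlane :=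
  (starConvex_one_slitPlane.isPathConnected one_mem_slitPlane).isConnected.isPreconnected

theorem logGamma_eq_stirlingR_one {z : ℂ} (hz : z ∈ slitPlane) :
    logGamma z = (z - 1 / 2) * log z - z + 1 / 2 * Real.log (2 * Real.pi) + stirlingR 1 z := by
  have hlog : DifferentiableOn ℂ log slitPlane := fun w hw =>
    (differentiableAt_log hw).differentiableWithinAt
  have hd : DifferentiableOn ℂ (fun z : ℂ => (z - 1 / 2) * log z - z
      + 1 / 2 * Real.log (2 * Real.pi) + stirlingR 1 z) slitPlane :=
    (((((differentiableOn_id.sub_const _).mul hlog).sub differentiableOn_id).add_const _).add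
      (differentiableOn_stirlingR le_rfl))
  refine (differentiableOn_logGamma.analyticOnNhd isOpen_slitPlane).eqOn_of_preconnected_of_frequently_eq
    (hd.analyticOnNhd isOpen_slitPlane) isPreconnected_slitPlane one_mem_slitPlane
    (frequently_ofReal_mem_nhdsNE_one fun x hx => logGamma_eq_stirlingR_one_ofReal hx) hz

theorem logGamma_eq_sum_stirlingT_add_stirlingR {k : ℕ} (hk : 1 ≤ k) {z : ℂ} (hz : z ∈ slitPlane) :
    logGamma z = (z - 1 / 2) * log z - z + 1 / 2 * Real.log (2 * Real.pi)
      + ∑ j ∈ Finset.Ico 1 k, stirlingT j z + stirlingR k z := by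
  induction k, hk using Nat.le_induction with
  | base => simpa using logGamma_eq_stirlingR_one hz
  | succ k hk ih =>
    rw [ih, Finset.sum_Ico_succ_top hk, stirlingR_eq_stirlingT_add hk hz]
    ring

theorem mem_slitPlane_of_re_nonneg {z : ℂ} (hz : 0 ≤ z.re) (hz0 : z ≠ 0) : z ∈ slitPlane := by
  rw [mem_slitPlane_iff]
  by_contra! h
  exact hz0 (Complex.ext (le_antisymm h.1 hz) h.2)

/-! ### Functional equations of `logGamma` -/

/-- Differentiating exp f = exp g and cancelling the exponential gives f' = g'. This lifts
multiplicative identities for Γ to `logGamma`, with one base point settling the multiple of 2πi. -/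
theorem eqOn_of_exp_eq {U : Set ℂ} (hU : IsOpen U) (hU' : IsPreconnected U) {f g : ℂ → ℂ}
    (hf : DifferentiableOn ℂ f U) (hg : DifferentiableOn ℂ g U)
    (h : ∀ z ∈ U, exp (f z) = exp (g z)) {a : ℂ} (ha : a ∈ U) (hfg : f a = g a) : EqOn f g U := by
  obtain ⟨c, hc⟩ := hU.exists_is_const_of_deriv_eq_zero hU' (hf.sub hg) fun z hz => by
    have hf' := (hf.differentiableAt (hU.mem_nhds hz)).hasDerivAt
    have hg' := (hg.differentiableAt (hU.mem_nhds hz)).hasDerivAt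
    have h1 : HasDerivAt (fun w => exp (f w)) (exp (g z) * deriv g z) z :=
      hg'.cexp.congr_of_eventuallyEq (by filter_upwards [hU.mem_nhds hz] with w hw using h w hw)
    have h2 := h1.unique hf'.cexp
    rw [h z hz] at h2
    rw [(hf'.sub hg').deriv, ← mul_left_cancel₀ (exp_ne_zero _) h2, sub_self, Pi.zero_apply]
  have h0 := hc a ha
  rw [Pi.sub_apply, hfg, sub_self] at h0
  intro z hz
  have := hc z hz
  rw [← h0, Pi.sub_apply] at this
  exact sub_eq_zero.1 this

theorem logGamma_one_half : logGamma (1 / 2) = (1 / 2 * Real.log Real.pi : ℝ) := by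
  have h := logGamma_ofReal (x := 1 / 2) (by norm_num)
  rw [Real.Gamma_one_half_eq, Real.log_sqrt Real.pi_pos.le] at h
  push_cast at h ⊢
  rw [h]
  ring

theorem add_one_half_mem_slitPlane {z : ℂ} (hz : z ∈ slitPlane) : z + 1 / 2 ∈ slitPlane := by
  rw [mem_slitPlane_iff] at hz ⊢
  have h1 : (z + 1 / 2).re = z.re + 1 / 2 := by simp
  have h2 : (z + 1 / 2).im = z.im := by simp
  rw [h1, h2]
  exact hz.imp_left fun h => by linarith

theorem two_mul_mem_slitPlane {z : ℂ} (hz : z ∈ slitPlane) : 2 * z ∈ slitPlane := by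
  rw [mem_slitPlane_iff] at hz ⊢
  simpa using hz

theorem logGamma_add_logGamma_add_half {z : ℂ} (hz : z ∈ slitPlane) :
    logGamma z + logGamma (z + 1 / 2) =
      logGamma (2 * z) + (1 - 2 * z) * Real.log 2 + 1 / 2 * Real.log Real.pi := by
  have hd := differentiableOn_logGamma
  refine eqOn_of_exp_eq (f := fun z => logGamma z + logGamma (z + 1 / 2))
    (g := fun z => logGamma (2 * z) + (1 - 2 * z) * Real.log 2 + 1 / 2 * Real.log Real.pi)
    isOpen_slitPlane isPreconnected_slitPlane
    (hd.add (hd.comp (by fun_prop) fun z hz => add_one_half_mem_slitPlane hz))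
    (((hd.comp (by fun_prop) fun z hz => two_mul_mem_slitPlane hz).add (by fun_prop)).add_const _)
    (fun z hz => ?_) (a := 1 / 2) (by simp [mem_slitPlane_iff]) ?_ hz
  · rw [exp_add, exp_add, exp_add, exp_logGamma hz, exp_logGamma (add_one_half_mem_slitPlane hz),
      exp_logGamma (two_mul_mem_slitPlane hz), Gamma_mul_Gamma_add_half,
      cpow_def_of_ne_zero two_ne_zero]
    congr 1
    · rw [mul_comm (1 - 2 * z), ofReal_log zero_le_two, ofReal_ofNat]
    · have : (1 / 2 * Real.log Real.pi : ℂ) = (Real.log √Real.pi : ℝ) := by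
        rw [Real.log_sqrt Real.pi_pos.le]
        push_cast
        ring
      rw [this, ← ofReal_exp, Real.exp_log (Real.sqrt_pos.2 Real.pi_pos)]
  · rw [show (1 / 2 + 1 / 2 : ℂ) = 1 by norm_num, show (2 * (1 / 2) : ℂ) = 1 by norm_num,
      logGamma_one, logGamma_one_half]
    push_cast
    ring

/-- For z = x + iy the real part is sin(πx) cosh(πy), positive in the strip; hence the principal
logarithm of sin(πz) is analytic there. -/
theorem sin_pi_mul_mem_slitPlane {z : ℂ} (h0 : 0 < z.re) (h1 : z.re < 1) :
    sin (Real.pi * z) ∈ slitPlane := by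
  rw [mem_slitPlane_iff]
  left
  rw [sin_eq, ← ofReal_sin, ← ofReal_cos, ← ofReal_cosh, ← ofReal_sinh]
  simp only [add_re, mul_re, mul_im, ofReal_re, ofReal_im, I_re, I_im]
  simp only [mul_zero, zero_mul, sub_zero, add_zero]
  refine mul_pos (Real.sin_pos_of_pos_of_lt_pi (mul_pos Real.pi_pos h0) ?_) (Real.cosh_pos _)
  nlinarith [Real.pi_pos]

theorem logGamma_add_logGamma_one_sub {z : ℂ} (h0 : 0 < z.re) (h1 : z.re < 1) :
    logGamma z + logGamma (1 - z) = Real.log Real.pi - log (sin (Real.pi * z)) := by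
  have hd := differentiableOn_logGamma
  have hm : ∀ w ∈ {w : ℂ | 0 < w.re} ∩ {w : ℂ | w.re < 1}, w ∈ slitPlane := fun w hw =>
    mem_slitPlane_iff.2 (Or.inl hw.1)
  have hm' : ∀ w ∈ {w : ℂ | 0 < w.re} ∩ {w : ℂ | w.re < 1}, 1 - w ∈ slitPlane := fun w hw => by
    refine mem_slitPlane_iff.2 (Or.inl ?_)
    rw [sub_re, one_re]
    exact sub_pos.2 hw.2
  refine eqOn_of_exp_eq (U := {w : ℂ | 0 < w.re} ∩ {w : ℂ | w.re < 1})
    (f := fun z => logGamma z + logGamma (1 - z))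
    (g := fun z => Real.log Real.pi - log (sin (Real.pi * z)))
    ((isOpen_lt continuous_const continuous_re).inter (isOpen_lt continuous_re continuous_const))
    ((convex_halfSpace_re_gt 0).inter (convex_halfSpace_re_lt 1)).isPreconnected
    ((hd.mono hm).add (hd.comp (by fun_prop) hm'))
    (DifferentiableOn.const_sub (DifferentiableOn.clog (by fun_prop)
      fun w hw => sin_pi_mul_mem_slitPlane hw.1 hw.2) _)
    (fun w hw => ?_) (a := 1 / 2) (by constructor <;> norm_num) ?_ ⟨h0, h1⟩
  · rw [exp_add, exp_logGamma (hm w hw), exp_logGamma (hm' w hw), Gamma_mul_Gamma_one_sub, exp_sub,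
      exp_log (slitPlane_ne_zero (sin_pi_mul_mem_slitPlane hw.1 hw.2)), ← ofReal_exp,
      Real.exp_log Real.pi_pos]
  · rw [show (1 - 1 / 2 : ℂ) = 1 / 2 by norm_num, logGamma_one_half, mul_one_div, sin_pi_div_two,
      log_one]
    push_cast
    ring

theorem conj_mem_slitPlane {z : ℂ} (hz : z ∈ slitPlane) : (starRingEnd ℂ) z ∈ slitPlane := by
  rw [mem_slitPlane_iff] at hz ⊢
  simpa using hz

theorem logGamma_conj {z : ℂ} (hz : z ∈ slitPlane) :
    logGamma ((starRingEnd ℂ) z) = (starRingEnd ℂ) (logGamma z) := by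
  have h := eqOn_of_exp_eq (f := logGamma)
    (g := (starRingEnd ℂ) ∘ logGamma ∘ (starRingEnd ℂ)) isOpen_slitPlane isPreconnected_slitPlane
    differentiableOn_logGamma (fun w hw => ?_) (fun w hw => ?_) one_mem_slitPlane ?_
    (conj_mem_slitPlane hz)
  · simpa using h
  · have := (hasDerivAt_logGamma (conj_mem_slitPlane hw)).differentiableAt.conj_conj
    rw [conj_conj] at this
    exact this.differentiableWithinAt
  · simp only [Function.comp]
    rw [exp_conj, exp_logGamma hw, exp_logGamma (conj_mem_slitPlane hw), Gamma_conj, conj_conj]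
  · simp [logGamma_one]

/-! ### The theta function through `logGamma (1 / 2 + i t)` -/

/-- With y = πt/2, sin(π/4 + iy) = (cosh y + i sinh y)/√2. Setting tan α = e^{-2y}, this has polar
form e^y/(2 cos α) · e^{i(π/4 - α)}. -/
theorem arg_sin_pi_mul (t : ℝ) : arg (sin (Real.pi * (I * t / 2 + 1 / 4))) =
    Real.pi / 4 - Real.arctan (Real.exp (-Real.pi * t)) := by
  set α := Real.arctan (Real.exp (-Real.pi * t)) with hα
  have hcos : 0 < Real.cos α := Real.cos_arctan_pos _
  have hsin : Real.sin α = Real.exp (-Real.pi * t) * Real.cos α := by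
    rw [← Real.tan_mul_cos hcos.ne', hα, Real.tan_arctan]
  have hexp : Real.exp (-Real.pi * t) = Real.exp (-(Real.pi * t / 2)) / Real.exp (Real.pi * t / 2) := by
    rw [← Real.exp_sub]
    ring_nf
  have hα1 : -(Real.pi / 2) < α := Real.neg_pi_div_two_lt_arctan _
  have hα2 : α < Real.pi / 2 := Real.arctan_lt_pi_div_two _
  have hr : 0 < Real.exp (Real.pi * t / 2) / (2 * Real.cos α) := by positivity
  have key : sin (Real.pi * (I * t / 2 + 1 / 4)) =
      ((Real.exp (Real.pi * t / 2) / (2 * Real.cos α) : ℝ) : ℂ) *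
        (cos ((Real.pi / 4 - α : ℝ) : ℂ) + sin ((Real.pi / 4 - α : ℝ) : ℂ) * I) := by
    have e : (Real.pi * (I * t / 2 + 1 / 4) : ℂ) =
        ((Real.pi / 4 : ℝ) : ℂ) + ((Real.pi * t / 2 : ℝ) : ℂ) * I := by
      push_cast
      ring
    rw [e, sin_add_mul_I, ← ofReal_sin, ← ofReal_cos, ← ofReal_cosh, ← ofReal_sinh, ← ofReal_cos,
      ← ofReal_sin, Real.cos_sub, Real.sin_sub, hsin, Real.cosh_eq, Real.sinh_eq, hexp,
      Real.cos_pi_div_four, Real.sin_pi_div_four]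
    have hne := (Real.exp_pos (Real.pi * t / 2)).ne'
    generalize Real.exp (Real.pi * t / 2) = E at *
    generalize Real.exp (-(Real.pi * t / 2)) = E' at *
    generalize Real.cos α = c at *
    apply Complex.ext
    · simp only [add_re, mul_re, mul_im, add_im, ofReal_re, ofReal_im, I_re, I_im]
      field_simp
      ring
    · simp only [add_re, mul_re, mul_im, add_im, ofReal_re, ofReal_im, I_re, I_im]
      field_simp
      ring
  rw [key, arg_mul_cos_add_sin_mul_I hr]
  constructor <;> linarith [Real.pi_pos]

theorem theta_eq_logGamma_one_half (t : ℝ) :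
    theta t = 1 / 2 * (logGamma (I * t + 1 / 2)).im - 1 / 2 * t * Real.log (2 * Real.pi)
      - Real.pi / 8 + 1 / 2 * Real.arctan (Real.exp (-Real.pi * t)) := by
  set s : ℂ := I * t / 2 + 1 / 4 with hs
  have hre : s.re = 1 / 4 := by simp [hs]
  have hmem : s ∈ slitPlane := mem_slitPlane_iff.2 (Or.inl (by rw [hre]; norm_num))
  have h1 := congrArg im (logGamma_add_logGamma_add_half hmem)
  have h2 := congrArg im (logGamma_add_logGamma_one_sub (z := s) (by rw [hre]; norm_num)
    (by rw [hre]; norm_num))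
  -- This holds because Re s = 1/4; it turns reflection into a formula for a difference of
  -- arguments.
  have e1 : 1 - s = (starRingEnd ℂ) (s + 1 / 2) := by
    apply Complex.ext
    · rw [conj_re, add_re, sub_re, hre]
      norm_num
    · rw [conj_im, add_im, sub_im]
      simp
  have e2 : 2 * s = I * t + 1 / 2 := by rw [hs]; ring
  have e3 : ((1 - 2 * s) * (Real.log 2 : ℂ)).im = -t * Real.log 2 := by
    rw [im_mul_ofReal, e2]
    simp
  have e4 : (1 / 2 * (Real.log Real.pi : ℂ)).im = 0 := by
    rw [show (1 / 2 * (Real.log Real.pi : ℂ)) = ((1 / 2 * Real.log Real.pi : ℝ) : ℂ) by push_cast; ring,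
      ofReal_im]
  rw [e1, logGamma_conj (add_one_half_mem_slitPlane hmem), add_im, conj_im, sub_im, ofReal_im, log_im,
    hs, arg_sin_pi_mul, ← hs] at h2
  rw [add_im, add_im, add_im, e3, e4, e2] at h1
  rw [theta, ← hs, Real.log_mul two_ne_zero Real.pi_ne_zero]
  linarith

/-! ### The terms of the expansion of the theta function -/

/-- Homogeneity gives T_j(2z) = 2^{1-2j} T_j(z), and B_{2j}(1/2) = (2^{1-2j} - 1) B_{2j}. -/
theorem gaussT_eq {j : ℕ} (hj : 1 ≤ j) (z : ℂ) :
    gaussT j z = (bernoulliFun (2 * j) (1 / 2) : ℂ) / (2 * j * (2 * j - 1) * z ^ (2 * j - 1)) := by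
  rw [gaussT, stirlingT, stirlingT, one_div, bernoulliFun_eval_half]
  have h : (2 : ℝ) ^ (2 * j) = 2 * 2 ^ (2 * j - 1) := by
    rw [← pow_succ']
    congr 1
    omega
  rw [h, mul_pow]
  push_cast
  simp only [div_eq_mul_inv, mul_inv]
  ring

theorem thetaT_eq {j : ℕ} (hj : 1 ≤ j) {t : ℝ} (ht : 0 < t) :
    thetaT j t = |bernoulliFun (2 * j) (1 / 2)| / (4 * j * (2 * j - 1) * t ^ (2 * j - 1)) := by
  have hj' : (1 : ℝ) ≤ j := by exact_mod_cast hj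
  have hpos : 0 < 2 * (j : ℝ) * (2 * j - 1) * t ^ (2 * j - 1) :=
    mul_pos (mul_pos (by linarith) (by linarith)) (pow_pos ht _)
  have h : gaussT j t = ((bernoulliFun (2 * j) (1 / 2) /
      (2 * j * (2 * j - 1) * t ^ (2 * j - 1)) : ℝ) : ℂ) := by
    rw [gaussT_eq hj]
    push_cast
    rfl
  rw [thetaT, h, norm_real, Real.norm_eq_abs, abs_div, abs_of_pos hpos, one_div_mul_eq_div, div_div]
  congr 1
  ring

/-- Euler's formula for ζ(2j), a sum of nonnegative terms, gives B_{2j} the sign (-1)^{j+1}; the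
factor 2^{1-2j} - 1 reverses it. -/
theorem neg_one_pow_mul_bernoulliFun_half_nonneg {j : ℕ} (hj : 1 ≤ j) :
    0 ≤ (-1) ^ j * bernoulliFun (2 * j) (1 / 2) := by
  have h1 := (hasSum_zeta_nat (k := j) (by omega)).nonneg fun n => by positivity
  have h2 : 0 ≤ (-1 : ℝ) ^ (j + 1) * bernoulli (2 * j) := by
    have hc : 0 < (2 : ℝ) ^ (2 * j - 1) * Real.pi ^ (2 * j) / (2 * j).factorial := by positivity
    refine nonneg_of_mul_nonneg_left (b := (2 : ℝ) ^ (2 * j - 1) * Real.pi ^ (2 * j) / (2 * j).factorial)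
      ?_ hc
    convert h1 using 1
    ring
  have h3 : (2 : ℝ) / 2 ^ (2 * j) ≤ 1 := by
    rw [div_le_one (by positivity)]
    calc (2 : ℝ) = 2 ^ 1 := (pow_one 2).symm
      _ ≤ 2 ^ (2 * j) := pow_le_pow_right₀ one_le_two (by omega)
  rw [one_div, bernoulliFun_eval_half]
  have h4 := mul_nonneg (sub_nonneg.2 h3) h2
  rw [pow_succ] at h4
  linarith

/-- The sign (-1)^j of B_{2j}(1/2) cancels the one from 1/i^{2j-1} = (-1)^j i, so all terms of the
expansion of ϑ enter with a plus sign. -/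
theorem gaussT_I_mul {j : ℕ} (hj : 1 ≤ j) {t : ℝ} (ht : 0 < t) :
    gaussT j (I * t) = 2 * thetaT j t * I := by
  have hs : |bernoulliFun (2 * j) (1 / 2)| = (-1) ^ j * bernoulliFun (2 * j) (1 / 2) := by
    rw [← abs_of_nonneg (neg_one_pow_mul_bernoulliFun_half_nonneg hj), abs_mul, abs_pow, abs_neg,
      abs_one, one_pow, one_mul]
  rw [gaussT_eq hj, thetaT_eq hj ht, hs]
  obtain ⟨n, rfl⟩ : ∃ n, j = n + 1 := ⟨j - 1, by omega⟩
  have hI : I ^ (2 * (n + 1) - 1) = (-1) ^ n * I := by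
    rw [show 2 * (n + 1) - 1 = 2 * n + 1 by omega, pow_succ, pow_mul, I_sq]
  have hm : ((-1 : ℂ) ^ n) * (-1) ^ n = 1 := by rw [← mul_pow]; simp
  have ht' : (t : ℂ) ≠ 0 := ofReal_ne_zero.2 ht.ne'
  have n1 : (n : ℂ) + 1 ≠ 0 := by exact_mod_cast n.succ_ne_zero
  have n2 : 2 * ((n : ℂ) + 1) - 1 ≠ 0 := by
    convert (show ((2 * n + 1 : ℕ) : ℂ) ≠ 0 by exact_mod_cast (2 * n).succ_ne_zero) using 1
    push_cast
    ring
  have hm0 : ((-1 : ℂ) ^ n) ≠ 0 := pow_ne_zero _ (by norm_num)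
  rw [mul_pow, hI]
  push_cast
  rw [pow_succ]
  generalize (-1 : ℂ) ^ n = e at *
  generalize (bernoulliFun (2 * (n + 1)) (1 / 2) : ℂ) = b
  field_simp
  linear_combination 4 * b * I_sq + 4 * b * I ^ 2 * hm

/-! ### The expansion of the theta function -/

theorem theta_eq_sum_thetaT_add_thetaR {k : ℕ} (hk : 1 ≤ k) {t : ℝ} (ht : 0 < t) :
    theta t = t / 2 * Real.log (t / (2 * Real.pi * Real.exp 1)) - Real.pi / 8
      + Real.arctan (Real.exp (-Real.pi * t)) / 2
      + ∑ j ∈ Finset.Ico 1 k, thetaT j t + thetaR k t := by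
  set z : ℂ := I * t with hz
  have hz0 : z ≠ 0 := mul_ne_zero I_ne_zero (ofReal_ne_zero.2 ht.ne')
  have hmem : z ∈ slitPlane := mem_slitPlane_of_re_nonneg (by simp [hz]) hz0
  have hlog : log z = Real.log t + Real.pi / 2 * I := by
    rw [hz, mul_comm, log_ofReal_mul ht I_ne_zero, log_I]
  have hlog2 : log (2 * z) = Real.log 2 + (Real.log t + Real.pi / 2 * I) := by
    rw [← hlog, ← log_ofReal_mul two_pos hz0, ofReal_ofNat]
  have hsum : ∑ j ∈ Finset.Ico 1 k, stirlingT j (2 * z) - ∑ j ∈ Finset.Ico 1 k, stirlingT j z =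
      2 * ((∑ j ∈ Finset.Ico 1 k, thetaT j t : ℝ) : ℂ) * I := by
    rw [← Finset.sum_sub_distrib, ofReal_sum, Finset.mul_sum, Finset.sum_mul]
    exact Finset.sum_congr rfl fun j hj => gaussT_I_mul (Finset.mem_Ico.1 hj).1 ht
  have h1 : logGamma (z + 1 / 2) =
      ((t * Real.log t - t + 2 * ∑ j ∈ Finset.Ico 1 k, thetaT j t : ℝ) : ℂ) * I
      + (1 / 2 * Real.log (2 * Real.pi) - Real.pi / 2 * t : ℝ)
      + gaussR k z := by
    have h := logGamma_add_logGamma_add_half hmem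
    rw [logGamma_eq_sum_stirlingT_add_stirlingR hk hmem,
      logGamma_eq_sum_stirlingT_add_stirlingR hk (two_mul_mem_slitPlane hmem), hlog, hlog2] at h
    rw [Real.log_mul two_ne_zero Real.pi_ne_zero] at h ⊢
    rw [gaussR]
    push_cast at h hsum ⊢
    rw [hz] at h hsum ⊢
    -- The `I_sq` term is the product of z = it with the iπ/2 in log(it).
    linear_combination h + hsum + (Real.pi / 2 * t) * I_sq
  have h2 := congrArg im h1
  rw [add_im, add_im, ofReal_im, im_ofReal_mul, I_im] at h2
  have h3 : thetaR k t = 1 / 2 * (gaussR k z).im := by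
    rw [thetaR, show (1 / 2 : ℂ) = ((1 / 2 : ℝ) : ℂ) by push_cast; ring, im_ofReal_mul]
  rw [theta_eq_logGamma_one_half, h2, h3, Real.log_div ht.ne' (by positivity),
    Real.log_mul (by positivity) (Real.exp_ne_zero _), Real.log_exp]
  ring

end RiemannSiegel

theorem mainTheorem8 :
    -- the representation of `ϑ` through `arg Γ(it + 1/2) = Im (ln Γ(it + 1/2))`
    (∀ t : ℝ, RiemannSiegel.theta t =
      1 / 2 * (RiemannSiegel.logGamma (Complex.I * t + 1 / 2)).im
        - 1 / 2 * t * Real.log (2 * Real.pi) - Real.pi / 8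
        + 1 / 2 * Real.arctan (Real.exp (-Real.pi * t))) ∧
    -- `R_k` is the remainder in Stirling's approximation
    (∀ k : ℕ, 1 ≤ k → ∀ z : ℂ, 0 ≤ z.re → z ≠ 0 →
      RiemannSiegel.logGamma z =
        (z - 1 / 2) * Complex.log z - z + 1 / 2 * Real.log (2 * Real.pi)
          + ∑ j ∈ Finset.Ico 1 k, RiemannSiegel.stirlingT j z + RiemannSiegel.stirlingR k z) ∧
    -- the closed form of `T̃_j`
    (∀ j : ℕ, 1 ≤ j → ∀ t : ℝ, 0 < t →
      RiemannSiegel.thetaT j t =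
        |bernoulliFun (2 * j) (1 / 2)| / (4 * j * (2 * j - 1) * t ^ (2 * j - 1))) ∧
    -- the approximation of `ϑ` with remainder `R̃_k`
    (∀ k : ℕ, 1 ≤ k → ∀ t : ℝ, 0 < t →
      RiemannSiegel.theta t =
        t / 2 * Real.log (t / (2 * Real.pi * Real.exp 1)) - Real.pi / 8
          + Real.arctan (Real.exp (-Real.pi * t)) / 2
          + ∑ j ∈ Finset.Ico 1 k, RiemannSiegel.thetaT j t + RiemannSiegel.thetaR k t) := by
  exact ⟨RiemannSiegel.theta_eq_logGamma_one_half,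
    fun _ hk _ hz hz0 =>
      RiemannSiegel.logGamma_eq_sum_stirlingT_add_stirlingR hk
        (RiemannSiegel.mem_slitPlane_of_re_nonneg hz hz0),
    fun _ hj _ ht => RiemannSiegel.thetaT_eq hj ht,
    fun _ hk _ ht => RiemannSiegel.theta_eq_sum_thetaT_add_thetaR hk ht⟩
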